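/- Let $N, n_1, n_2, n_3$ be positive integers with $n_1+n_2+n_3=N$. Let $C(n_1,n_2,n_3)$ be the abstract simplicial complex whose vertex set is $\mathbb{Z}/N$, whose $1$-simplices are all translates (mod $N$) of $\{0,n_1\}$, $\{0,n_2\}$ and $\{0,n_3\}$, and whose $2$-simplices are all translates and all inversions (images under maps $i\mapsto k-i$, $k\in\mathbb{Z}/N$) of $\{0,n_1,n_1+n_2\}$; write $C(n_1,n_2,n_3)$ also for its geometric realization. If $n_1<n_2<n_3$ and $n_3\neq N/2$, then the space $C(n_1,n_2,n_3)$ is a disjoint union of tori: for some integer $d\geq 1$ it is homeomorphic to the topological disjoint union of $d$ copies of the torus $(\mathbb{R}/\mathbb{Z})^2$. -/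

import Mathlib

/-- The generalized Tonnetz `C(n₁, n₂, n₃)`, for `n₁ + n₂ + n₃ = N`: the abstract simplicial
complex whose vertices are the elements of `ℤ/N`, whose edges are the translates of `{0, n₁}`,
`{0, n₂}`, `{0, n₃}`, and whose triangles are the translates `{k, k + n₁, k + n₁ + n₂}` and the
inversions (images under `i ↦ k - i`) `{k, k - n₁, k - n₁ - n₂}` of `{0, n₁, n₁ + n₂}`. -/
def tonnetz (N n₁ n₂ n₃ : ℕ) (hN : n₁ + n₂ + n₃ = N) : AbstractSimplicialComplex (ZMod N) where
  faces := {s |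
    (∃ k : ZMod N, s = {k}) ∨
    (∃ k : ZMod N, s = {k, k + n₁} ∨ s = {k, k + n₂} ∨ s = {k, k + n₃}) ∨
    (∃ k : ZMod N, s = {k, k + n₁, k + n₁ + n₂} ∨ s = {k, k - n₁, k - n₁ - n₂})}
  isRelLowerSet_faces := by
    have h0 : (n₁ : ZMod N) + n₂ + n₃ = 0 := by
      rw [← ZMod.natCast_self N, ← hN]; push_cast; rfl
    -- nonempty subsets of pairs and of triples
    have pair : ∀ (t : Finset (ZMod N)) (a b : ZMod N), t ⊆ {a, b} → t.Nonempty →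
        t = {a} ∨ t = {b} ∨ t = {a, b} := by
      intro t a b ht hne
      have := Finset.mem_powerset.mpr ht
      by_cases ha : a ∈ t <;> by_cases hb : b ∈ t <;> grind
    have triple : ∀ (t : Finset (ZMod N)) (a b c : ZMod N), t ⊆ {a, b, c} →
        t ⊆ {a, b} ∨ t ⊆ {b, c} ∨ t ⊆ {a, c} ∨ t = {a, b, c} := by
      intro t a b c ht
      by_cases ha : a ∈ t <;> by_cases hb : b ∈ t <;> by_cases hc : c ∈ t <;> grind
    -- nonempty subsets of an edge are simplices
    have edge : ∀ (a b : ZMod N) (t : Finset (ZMod N)), t ⊆ {a, b} → t.Nonempty →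
        (∃ k : ZMod N, ({a, b} : Finset (ZMod N)) = {k, k + n₁} ∨
          ({a, b} : Finset (ZMod N)) = {k, k + n₂} ∨ ({a, b} : Finset (ZMod N)) = {k, k + n₃}) →
        (∃ k : ZMod N, t = {k}) ∨
        (∃ k : ZMod N, t = {k, k + n₁} ∨ t = {k, k + n₂} ∨ t = {k, k + n₃}) := by
      intro a b t ht hne h
      rcases pair t a b ht hne with rfl | rfl | rfl
      · exact Or.inl ⟨_, rfl⟩
      · exact Or.inl ⟨_, rfl⟩
      · exact Or.inr h
    intro s hs
    refine ⟨?_, fun t ht hne => ?_⟩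
    · rcases hs with ⟨k, rfl⟩ | ⟨k, rfl | rfl | rfl⟩ | ⟨k, rfl | rfl⟩ <;> simp
    · rcases hs with ⟨k, rfl⟩ | ⟨k, rfl | rfl | rfl⟩ | ⟨k, rfl | rfl⟩
      · exact Or.inl ⟨k, (Finset.Nonempty.subset_singleton_iff hne).mp ht⟩
      · apply or_assoc.mp; exact Or.inl (edge _ _ t ht hne ⟨k, Or.inl rfl⟩)
      · apply or_assoc.mp; exact Or.inl (edge _ _ t ht hne ⟨k, Or.inr (Or.inl rfl)⟩)
      · apply or_assoc.mp; exact Or.inl (edge _ _ t ht hne ⟨k, Or.inr (Or.inr rfl)⟩)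
      · apply or_assoc.mp
        have e : k = k + n₁ + n₂ + n₃ := by linear_combination -h0
        rcases triple t _ _ _ ht with h | h | h | h
        · exact Or.inl (edge _ _ t h hne ⟨k, Or.inl rfl⟩)
        · exact Or.inl (edge _ _ t h hne ⟨k + n₁, Or.inr (Or.inl rfl)⟩)
        · refine Or.inl (edge _ _ t h hne ⟨k + n₁ + n₂, Or.inr (Or.inr ?_)⟩)
          rw [← e, Finset.pair_comm]
        · exact Or.inr ⟨k, Or.inl h⟩
      · apply or_assoc.mp
        rcases triple t _ _ _ ht with h | h | h | h
        · refine Or.inl (edge _ _ t h hne ⟨k - n₁, Or.inl ?_⟩)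
          rw [sub_add_cancel, Finset.pair_comm]
        · refine Or.inl (edge _ _ t h hne ⟨k - n₁ - n₂, Or.inr (Or.inl ?_)⟩)
          rw [sub_add_cancel, Finset.pair_comm]
        · refine Or.inl (edge _ _ t h hne ⟨k, Or.inr (Or.inr ?_)⟩)
          rw [show k - (n₁ : ZMod N) - n₂ = k + n₃ by linear_combination -h0]
        · exact Or.inr ⟨k, Or.inr h⟩
  singleton_mem v := Or.inl ⟨v, rfl⟩

/-- The geometric realization of an abstract simplicial complex `K` on a finite vertex set `ι`, in
barycentric coordinates: vertices are placed at the standard basis vectors of `ι → ℝ`, and the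
realization is the union of the simplices spanned by the faces of `K`, i.e. the set of points of
the standard simplex that are supported in some face. It carries the subspace topology. -/
def geometricRealization {ι : Type*} [Fintype ι] (K : AbstractSimplicialComplex ι) :
    Set (ι → ℝ) :=
  {x | x ∈ stdSimplex ℝ ι ∧ ∃ s ∈ K.faces, ∀ i, i ∉ s → x i = 0}

/-!
The universal cover of each component of the Tonnetz is the plane, triangulated with vertex set `ℤ²`
and edges in the directions `(1, 0)`, `(0, 1)`, `(1, 1)`. Label the vertex `(i, j)` by
`c + i n₁ + j n₂ ∈ ℤ/N`. The two kinds of triangles are then labelled by the translates and the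
inversions of `{0, n₁, n₁ + n₂}`, so the labelling extends to a piecewise affine map `foldMap` from
the plane to the realization. Each coordinate of this map is a locally finite sum of hat functions,
which makes continuity plain; on each triangle it is given by `foldMap_lower` and `foldMap_upper`,
and since every face lies in a triangle, the maps for all `c` together are surjective
(`exists_foldMap_eq`).

The hypotheses on `n₁, n₂, n₃` make the labels of a vertex and of its six neighbours distinct
(`starInjective_tonnetz`). Hence `foldMap` is injective on the open star of each vertex, and
two points have the same image if and only if they differ by a label-preserving lattice
translation (`foldMap_eq_iff`). Letting `c` run over representatives of the cosets of the
subgroup `⟨n₁, n₂⟩` of `ℤ/N`, the realization is thus the disjoint union, over these cosets, of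
the plane modulo the lattice `{(i, j) | i n₁ + j n₂ = 0 in ℤ/N}`. This lattice has rank two
(`exists_basis_of_dvd`), so each quotient is a torus, and the resulting continuous bijection from
a compact space to a Hausdorff space is a homeomorphism (`nonempty_sigma_torus_homeomorph`).
-/

/-! ### Hat functions of the triangulated plane -/

/-- The hat function at the origin of the triangulation of the plane with vertex set `ℤ²` and edges
in the directions `(1, 0)`, `(0, 1)`, `(1, 1)`: it is `1` at the origin, `0` at every other vertex,
and affine on each triangle. Its support is the hexagon formed by the six triangles at the
origin. -/
noncomputable def hexHat (p : ℝ × ℝ) : ℝ := max 0 (1 - max (max |p.1| |p.2|) |p.1 - p.2|)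

theorem continuous_hexHat : Continuous hexHat := by unfold hexHat; fun_prop

theorem hexHat_nonneg (p : ℝ × ℝ) : 0 ≤ hexHat p := le_max_left _ _

theorem hexHat_pos_iff {p : ℝ × ℝ} : 0 < hexHat p ↔ |p.1| < 1 ∧ |p.2| < 1 ∧ |p.1 - p.2| < 1 := by
  simp [hexHat, and_assoc]

theorem hexHat_neg (p : ℝ × ℝ) : hexHat (-p) = hexHat p := by
  simp only [hexHat, Prod.fst_neg, Prod.snd_neg, abs_neg, neg_sub_neg, abs_sub_comm p.2 p.1]

/-- On the open star of the origin, the hat function at the neighbour `(1, 0)` in terms of the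
coordinates. -/
theorem hexHat_sub_one_zero {x y : ℝ} (h : 0 < hexHat (x, y)) :
    hexHat ((x, y) - (1, 0)) = max 0 (min x (x - y)) := by
  obtain ⟨h1, h2, h3⟩ := hexHat_pos_iff.1 h
  simp only [abs_lt] at h1 h2 h3
  simp only [hexHat, Prod.mk_sub_mk, sub_zero]
  rw [abs_of_nonpos (by linarith : x - 1 ≤ 0), abs_of_nonpos (by linarith : x - 1 - y ≤ 0)]
  congr 1
  grind

/-- On the open star of the origin, the hat function at the neighbour `(1, 1)` in terms of the
coordinates. -/
theorem hexHat_sub_one_one {x y : ℝ} (h : 0 < hexHat (x, y)) :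
    hexHat ((x, y) - (1, 1)) = max 0 (min x y) := by
  obtain ⟨h1, h2, h3⟩ := hexHat_pos_iff.1 h
  simp only [abs_lt] at h1 h2 h3
  simp only [hexHat, Prod.mk_sub_mk, sub_sub_sub_cancel_right]
  rw [abs_of_nonpos (by linarith : x - 1 ≤ 0), abs_of_nonpos (by linarith : y - 1 ≤ 0)]
  congr 1
  grind

/-- A point of the open star of the origin is recovered from its barycentric coordinates: this is
the first component of `p = ∑ v, hexHat (p - v) • v`, in which only the neighbours of the origin
with nonzero first coordinate contribute. -/
theorem fst_eq_hexHat {p : ℝ × ℝ} (hp : 0 < hexHat p) :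
    p.1 = hexHat (p - (1, 0)) + hexHat (p - (1, 1)) -
      hexHat (p - (-1, 0)) - hexHat (p - (-1, -1)) := by
  obtain ⟨x, y⟩ := p
  have hn : 0 < hexHat (-x, -y) := by rwa [← hexHat_neg] at hp
  have e1 : hexHat ((x, y) - (-1, 0)) = max 0 (min (-x) (-x - -y)) := by
    rw [← hexHat_sub_one_zero hn, ← hexHat_neg]
    congr 1
    ext <;> simp; ring
  have e2 : hexHat ((x, y) - (-1, -1)) = max 0 (min (-x) (-y)) := by
    rw [← hexHat_sub_one_one hn, ← hexHat_neg]
    congr 1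
    ext <;> simp <;> ring
  rw [hexHat_sub_one_zero hp, hexHat_sub_one_one hp, e1, e2]
  grind

theorem hexHat_swap (p : ℝ × ℝ) : hexHat p.swap = hexHat p := by
  simp only [hexHat, Prod.fst_swap, Prod.snd_swap, abs_sub_comm p.2 p.1, max_comm |p.2|]

/-- The second component of `p = ∑ v, hexHat (p - v) • v` on the open star of the origin. -/
theorem snd_eq_hexHat {p : ℝ × ℝ} (hp : 0 < hexHat p) :
    p.2 = hexHat (p - (0, 1)) + hexHat (p - (1, 1)) -
      hexHat (p - (0, -1)) - hexHat (p - (-1, -1)) := by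
  have := fst_eq_hexHat (p := p.swap) (by rwa [hexHat_swap])
  rw [← hexHat_swap (_ - _), ← hexHat_swap (p.swap - (1, 1)), ← hexHat_swap (p.swap - (-1, 0)),
    ← hexHat_swap (p.swap - (-1, -1))] at this
  exact this

/-- The inclusion of `ℤ²` in the plane. -/
def latticePoint (v : ℤ × ℤ) : ℝ × ℝ := (v.1, v.2)

theorem latticePoint_add (v w : ℤ × ℤ) :
    latticePoint (v + w) = latticePoint v + latticePoint w := by
  simp [latticePoint]

/-- A point of a unit square lies in the open stars of corners of that square only. -/
theorem mem_unitSquare_of_hexHat_pos {p : ℝ × ℝ} {m v : ℤ × ℤ}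
    (h1 : p.1 ∈ Set.Icc (m.1 : ℝ) (m.1 + 1)) (h2 : p.2 ∈ Set.Icc (m.2 : ℝ) (m.2 + 1))
    (h : 0 < hexHat (p - latticePoint v)) :
    v = m ∨ v = m + (1, 0) ∨ v = m + (0, 1) ∨ v = m + (1, 1) := by
  obtain ⟨a1, a2, -⟩ := hexHat_pos_iff.1 h
  simp only [latticePoint, Prod.fst_sub, Prod.snd_sub, abs_lt, Set.mem_Icc] at *
  have b1 : m.1 - 1 < v.1 := by exact_mod_cast (by push_cast; linarith : ((m.1 - 1 : ℤ) : ℝ) < v.1)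
  have b2 : v.1 < m.1 + 2 := by exact_mod_cast (by push_cast; linarith : (v.1 : ℝ) < (m.1 + 2 : ℤ))
  have b3 : m.2 - 1 < v.2 := by exact_mod_cast (by push_cast; linarith : ((m.2 - 1 : ℤ) : ℝ) < v.2)
  have b4 : v.2 < m.2 + 2 := by exact_mod_cast (by push_cast; linarith : (v.2 : ℝ) < (m.2 + 2 : ℤ))
  simp only [Prod.ext_iff, Prod.fst_add, Prod.snd_add]
  omega

/-- Interpolation of a function on `ℤ²` by hat functions, on the lower triangle
`m, m + (1, 0), m + (1, 1)` of a unit square. -/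
theorem finsum_hexHat_lower (g : ℤ × ℤ → ℝ) (m : ℤ × ℤ) {s t : ℝ} (ht : 0 ≤ t) (hts : t ≤ s)
    (hs : s ≤ 1) :
    ∑ᶠ v, g v * hexHat (latticePoint m + (s, t) - latticePoint v) =
      g m * (1 - s) + g (m + (1, 0)) * (s - t) + g (m + (1, 1)) * t := by
  rw [finsum_eq_sum_of_support_subset (s := {m, m + (1, 0), m + (0, 1), m + (1, 1)})]
  · rw [Finset.sum_insert, Finset.sum_insert, Finset.sum_insert, Finset.sum_singleton]
    · have e0 : hexHat (latticePoint m + (s, t) - latticePoint m) = 1 - s := by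
        simp only [hexHat, latticePoint, Prod.mk_add_mk, Prod.mk_sub_mk]; grind
      have e1 : hexHat (latticePoint m + (s, t) - latticePoint (m + (1, 0))) = s - t := by
        simp only [hexHat, latticePoint, Prod.mk_add_mk, Prod.mk_sub_mk, Prod.fst_add, Prod.snd_add]
        push_cast; grind
      have e2 : hexHat (latticePoint m + (s, t) - latticePoint (m + (0, 1))) = 0 := by
        simp only [hexHat, latticePoint, Prod.mk_add_mk, Prod.mk_sub_mk, Prod.fst_add, Prod.snd_add]
        push_cast; grind
      have e3 : hexHat (latticePoint m + (s, t) - latticePoint (m + (1, 1))) = t := by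
        simp only [hexHat, latticePoint, Prod.mk_add_mk, Prod.mk_sub_mk, Prod.fst_add, Prod.snd_add]
        push_cast; grind
      rw [e0, e1, e2, e3]; ring
    all_goals simp [Prod.ext_iff]
  · intro v hv
    have : 0 < hexHat (latticePoint m + (s, t) - latticePoint v) :=
      lt_of_le_of_ne (hexHat_nonneg _) (Ne.symm (right_ne_zero_of_mul hv))
    have := mem_unitSquare_of_hexHat_pos (m := m) (by simp [latticePoint]; constructor <;> linarith)
      (by simp [latticePoint]; constructor <;> linarith) this
    simpa using this

/-- Interpolation of a function on `ℤ²` by hat functions, on the upper triangle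
`m, m + (0, 1), m + (1, 1)` of a unit square. -/
theorem finsum_hexHat_upper (g : ℤ × ℤ → ℝ) (m : ℤ × ℤ) {s t : ℝ} (hs : 0 ≤ s) (hst : s ≤ t)
    (ht : t ≤ 1) :
    ∑ᶠ v, g v * hexHat (latticePoint m + (s, t) - latticePoint v) =
      g m * (1 - t) + g (m + (0, 1)) * (t - s) + g (m + (1, 1)) * s := by
  have h := finsum_hexHat_lower (fun v => g v.swap) m.swap hs hst ht
  rw [← finsum_comp_equiv (Equiv.prodComm ℤ ℤ)] at h
  simp only [Equiv.prodComm_apply, Prod.swap_swap] at h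
  refine Eq.trans (finsum_congr fun v => ?_) h
  rw [← hexHat_swap]; rfl

/-! ### Folding the plane along a labelling of its vertices -/

section
variable {G : Type*} [AddCommGroup G]

/-- The homomorphism `(i, j) ↦ i • a + j • b`. -/
def latticeHom (a b : G) : ℤ × ℤ →+ G where
  toFun v := v.1 • a + v.2 • b
  map_zero' := by simp
  map_add' v w := by simp only [Prod.fst_add, Prod.snd_add, add_smul]; abel

theorem latticeHom_apply (a b : G) (v : ℤ × ℤ) : latticeHom a b v = v.1 • a + v.2 • b := rfl

variable [DecidableEq G]

/-- The piecewise affine map that extends the vertex map `v ↦ c + v.1 • a + v.2 • b` from `ℤ²` to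
the triangulated plane, with values in barycentric coordinates: the coordinate of the image of `p`
at `k` is the sum of the barycentric coordinates of `p` at the vertices labelled `k`. -/
noncomputable def foldMap (a b c : G) (p : ℝ × ℝ) : G → ℝ := fun k =>
  ∑ᶠ v : ℤ × ℤ, (if c + latticeHom a b v = k then 1 else 0) * hexHat (p - latticePoint v)

variable (a b c : G)

theorem continuous_foldMap : Continuous (foldMap a b c) := by
  refine continuous_pi fun k => continuous_finsum (fun v => continuous_const.mul
    (continuous_hexHat.comp (continuous_id.sub continuous_const))) fun p => ?_
  refine ⟨Metric.ball p 1, Metric.ball_mem_nhds p one_pos, ?_⟩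
  refine ((Set.finite_Icc ⌊p.1 - 2⌋ ⌈p.1 + 2⌉).prod (Set.finite_Icc ⌊p.2 - 2⌋ ⌈p.2 + 2⌉)).subset ?_
  rintro v ⟨q, hq, hqp⟩
  obtain ⟨h1, h2, -⟩ := hexHat_pos_iff.1
    (lt_of_le_of_ne (hexHat_nonneg _) (Ne.symm (right_ne_zero_of_mul hq)))
  rw [Metric.mem_ball, Prod.dist_eq, max_lt_iff, Real.dist_eq, Real.dist_eq] at hqp
  simp only [latticePoint, Prod.fst_sub, Prod.snd_sub, abs_lt] at *
  refine ⟨⟨?_, ?_⟩, ⟨?_, ?_⟩⟩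
  · exact Int.cast_le.1 ((Int.floor_le _).trans (by linarith : p.1 - 2 ≤ (v.1 : ℝ)))
  · exact Int.cast_le.1 ((by linarith : (v.1 : ℝ) ≤ p.1 + 2).trans (Int.le_ceil _))
  · exact Int.cast_le.1 ((Int.floor_le _).trans (by linarith : p.2 - 2 ≤ (v.2 : ℝ)))
  · exact Int.cast_le.1 ((by linarith : (v.2 : ℝ) ≤ p.2 + 2).trans (Int.le_ceil _))

theorem foldMap_add_latticePoint (p : ℝ × ℝ) (w : ℤ × ℤ) :
    foldMap a b c (p + latticePoint w) = foldMap a b (c + latticeHom a b w) p := by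
  funext k
  unfold foldMap
  rw [← finsum_comp_equiv (Equiv.addRight w)]
  refine finsum_congr fun v => ?_
  simp only [Equiv.coe_addRight, map_add, latticePoint_add, add_sub_add_right_eq_sub]
  rw [add_assoc c, add_comm (latticeHom a b w)]

theorem foldMap_lower (m : ℤ × ℤ) {s t : ℝ} (ht : 0 ≤ t) (hts : t ≤ s) (hs : s ≤ 1) :
    foldMap a b c (latticePoint m + (s, t)) =
      Pi.single (c + latticeHom a b m) (1 - s) + Pi.single (c + latticeHom a b m + a) (s - t) +
        Pi.single (c + latticeHom a b m + a + b) t := by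
  funext k
  rw [foldMap, finsum_hexHat_lower _ m ht hts hs]
  have e1 : c + latticeHom a b (m + (1, 0)) = c + latticeHom a b m + a := by
    rw [map_add]; simp [latticeHom_apply, add_assoc]
  have e2 : c + latticeHom a b (m + (1, 1)) = c + latticeHom a b m + a + b := by
    rw [map_add]; simp [latticeHom_apply, add_assoc]
  simp only [e1, e2, Pi.add_apply, Pi.single_apply, eq_comm (a := k), ite_mul, one_mul, zero_mul]

theorem foldMap_upper (m : ℤ × ℤ) {s t : ℝ} (hs : 0 ≤ s) (hst : s ≤ t) (ht : t ≤ 1) :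
    foldMap a b c (latticePoint m + (s, t)) =
      Pi.single (c + latticeHom a b m) (1 - t) + Pi.single (c + latticeHom a b m + b) (t - s) +
        Pi.single (c + latticeHom a b m + a + b) s := by
  funext k
  rw [foldMap, finsum_hexHat_upper _ m hs hst ht]
  have e1 : c + latticeHom a b (m + (0, 1)) = c + latticeHom a b m + b := by
    rw [map_add]; simp [latticeHom_apply, add_assoc]
  have e2 : c + latticeHom a b (m + (1, 1)) = c + latticeHom a b m + a + b := by
    rw [map_add]; simp [latticeHom_apply, add_assoc]
  simp only [e1, e2, Pi.add_apply, Pi.single_apply, eq_comm (a := k), ite_mul, one_mul, zero_mul]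

theorem exists_latticePoint_add (p : ℝ × ℝ) : ∃ (m : ℤ × ℤ) (s t : ℝ),
    p = latticePoint m + (s, t) ∧ 0 ≤ s ∧ s < 1 ∧ 0 ≤ t ∧ t < 1 :=
  ⟨(⌊p.1⌋, ⌊p.2⌋), Int.fract p.1, Int.fract p.2,
    Prod.ext (Int.floor_add_fract _).symm (Int.floor_add_fract _).symm,
    Int.fract_nonneg _, Int.fract_lt_one _, Int.fract_nonneg _, Int.fract_lt_one _⟩

/-- The labels of the origin and of its six neighbours are pairwise distinct. The condition
`|v.1| ≤ 1`, `|v.2| ≤ 1`, `|v.1 - v.2| ≤ 1` describes these seven points of `ℤ²`. -/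
def StarInjective : Prop :=
  ∀ v w : ℤ × ℤ, latticeHom a b v = latticeHom a b w →
    |v.1| ≤ 1 → |v.2| ≤ 1 → |v.1 - v.2| ≤ 1 → |w.1| ≤ 1 → |w.2| ≤ 1 → |w.1 - w.2| ≤ 1 → v = w

variable {a b}

/-- On the open star of the origin, the coordinates of the image are the barycentric coordinates of
the point itself, since no two vertices of the closed star carry the same label. -/
theorem foldMap_star (hinj : StarInjective a b) {p : ℝ × ℝ} (hp : 0 < hexHat p) {w : ℤ × ℤ}
    (h1 : |w.1| ≤ 1) (h2 : |w.2| ≤ 1) (h3 : |w.1 - w.2| ≤ 1) :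
    foldMap a b c p (c + latticeHom a b w) = hexHat (p - latticePoint w) := by
  rw [foldMap, finsum_eq_single _ w, if_pos rfl, one_mul]
  intro v hv
  by_contra h
  obtain ⟨a1, a2, a3⟩ := hexHat_pos_iff.1
    (lt_of_le_of_ne (hexHat_nonneg _) (Ne.symm (right_ne_zero_of_mul h)))
  have hφ : latticeHom a b v = latticeHom a b w := by
    by_contra h'
    exact left_ne_zero_of_mul h (if_neg (by simpa using h'))
  obtain ⟨b1, b2, b3⟩ := hexHat_pos_iff.1 hp
  have key : ∀ (x : ℝ) (n : ℤ), |x| < 1 → |x - n| < 1 → |n| ≤ 1 := by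
    intro x n hx hn
    have : |(n : ℝ)| < 2 := by rw [abs_lt] at *; constructor <;> linarith
    have : |n| < 2 := by exact_mod_cast this
    omega
  refine hv (hinj v w hφ (key _ _ b1 a1) (key _ _ b2 a2) (key _ _ b3 ?_) h1 h2 h3)
  convert a3 using 2
  simp [latticePoint]; ring

theorem foldMap_injOn_star (hinj : StarInjective a b) {p q : ℝ × ℝ} (hp : 0 < hexHat p)
    (hq : 0 < hexHat q) (h : foldMap a b c p = foldMap a b c q) : p = q := by
  have key : ∀ w : ℤ × ℤ, |w.1| ≤ 1 → |w.2| ≤ 1 → |w.1 - w.2| ≤ 1 →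
      hexHat (p - latticePoint w) = hexHat (q - latticePoint w) := fun w h1 h2 h3 => by
    rw [← foldMap_star c hinj hp h1 h2 h3, h, foldMap_star c hinj hq h1 h2 h3]
  have k1 := key (1, 0) (by simp) (by simp) (by simp)
  have k2 := key (0, 1) (by simp) (by simp) (by simp)
  have k3 := key (1, 1) (by simp) (by simp) (by simp)
  have k4 := key (-1, 0) (by simp) (by simp) (by simp)
  have k5 := key (0, -1) (by simp) (by simp) (by simp)
  have k6 := key (-1, -1) (by simp) (by simp) (by simp)
  simp only [latticePoint, Int.cast_one, Int.cast_zero, Int.cast_neg] at k1 k2 k3 k4 k5 k6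
  refine Prod.ext ?_ ?_
  · rw [fst_eq_hexHat hp, fst_eq_hexHat hq, k1, k3, k4, k6]
  · rw [snd_eq_hexHat hp, snd_eq_hexHat hq, k2, k3, k5, k6]

/-- Points have the same image exactly when they differ by a translation that respects labels. For
the nontrivial direction, translate so that a vertex of the carrier of each point, with the same
label, moves to the origin; both points then lie in its open star, where the map is injective. -/
theorem foldMap_eq_iff (hinj : StarInjective a b) {c c' : G} {p q : ℝ × ℝ} :
    foldMap a b c p = foldMap a b c' q ↔
      ∃ w : ℤ × ℤ, p = q + latticePoint w ∧ c' = c + latticeHom a b w := by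
  constructor
  · intro h
    -- a vertex whose open star contains `p`
    obtain ⟨v, hv⟩ : ∃ v, 0 < hexHat (p - latticePoint v) := by
      obtain ⟨m, s, t, rfl, hs, hs1, ht, ht1⟩ := exists_latticePoint_add p
      refine ⟨m, hexHat_pos_iff.2 ?_⟩
      simp only [add_sub_cancel_left, abs_lt]
      refine ⟨⟨?_, ?_⟩, ⟨?_, ?_⟩, ?_, ?_⟩ <;> linarith
    have hp : foldMap a b c p = foldMap a b (c + latticeHom a b v) (p - latticePoint v) := by
      rw [← foldMap_add_latticePoint, sub_add_cancel]
    have hpos : 0 < foldMap a b c' q (c + latticeHom a b v) := by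
      rw [← h, hp]
      have := foldMap_star (c + latticeHom a b v) hinj hv (w := 0) (by simp) (by simp) (by simp)
      rw [map_zero, add_zero] at this
      rw [this]
      convert hv using 2
      simp [latticePoint]
    obtain ⟨w, hw⟩ : ∃ w, (if c' + latticeHom a b w = c + latticeHom a b v then 1 else 0) *
        hexHat (q - latticePoint w) ≠ 0 := by
      by_contra! h0
      exact hpos.ne' (finsum_eq_zero_of_forall_eq_zero h0)
    have hq0 := lt_of_le_of_ne (hexHat_nonneg _) (Ne.symm (right_ne_zero_of_mul hw))
    have hc : c' + latticeHom a b w = c + latticeHom a b v := by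
      by_contra h'
      exact left_ne_zero_of_mul hw (if_neg h')
    have hq : foldMap a b c' q = foldMap a b (c + latticeHom a b v) (q - latticePoint w) := by
      rw [← hc, ← foldMap_add_latticePoint, sub_add_cancel]
    have := foldMap_injOn_star _ hinj hv hq0 (by rw [← hp, ← hq, h])
    refine ⟨v - w, ?_, ?_⟩
    · have e := latticePoint_add (v - w) w
      rw [sub_add_cancel] at e
      rw [eq_sub_of_add_eq e.symm]
      linear_combination (exp := 1) this
    · rw [map_sub, eq_sub_of_add_eq hc]; abel
  · rintro ⟨w, rfl, rfl⟩
    rw [foldMap_add_latticePoint]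

end

/-! ### The lattice of label-preserving translations -/

/-- Hermite normal form of the lattice `{v ∈ ℤ² | N ∣ v.1 * n₁ + v.2 * n₂}`: it has a basis of the
form `(p, 0)`, `(q, r)` with `p, r ≠ 0`. -/
theorem exists_basis_of_dvd (N n₁ n₂ : ℕ) (hN : N ≠ 0) :
    ∃ p q r : ℤ, p ≠ 0 ∧ r ≠ 0 ∧ ∀ v : ℤ × ℤ, (N : ℤ) ∣ v.1 * n₁ + v.2 * n₂ ↔
      ∃ m : ℤ × ℤ, v = (m.1 * p + m.2 * q, m.2 * r) := by
  -- `N = g P` and `n₁ = g M` with `P`, `M` coprime;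
  -- then `g = d R` and `n₂ = d S` with `R`, `S` coprime
  obtain ⟨g, P, M, hg, hPM, hP, hM⟩ :
      ∃ g P M : ℤ, g ≠ 0 ∧ IsCoprime P M ∧ (N : ℤ) = g * P ∧ n₁ = g * M := by
    have hg : (Int.gcd N n₁ : ℤ) ≠ 0 := by
      simp [hN]
    obtain ⟨P, hP⟩ := Int.gcd_dvd_left (a := (N : ℤ)) (b := n₁)
    obtain ⟨M, hM⟩ := Int.gcd_dvd_right (a := (N : ℤ)) (b := n₁)
    refine ⟨_, P, M, hg, ?_, hP, hM⟩
    obtain ⟨x, y, h⟩ : ∃ x y : ℤ, (Int.gcd N n₁ : ℤ) = N * x + n₁ * y :=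
      ⟨_, _, Int.gcd_eq_gcd_ab _ _⟩
    refine ⟨x, y, mul_left_cancel₀ hg ?_⟩
    linear_combination -h - x * hP - y * hM
  obtain ⟨d, R, S, hd, hRS, hR, hS⟩ :
      ∃ d R S : ℤ, d ≠ 0 ∧ IsCoprime R S ∧ g = d * R ∧ n₂ = d * S := by
    have hd : (Int.gcd g n₂ : ℤ) ≠ 0 := by
      simp [Int.gcd_eq_zero_iff, hg]
    obtain ⟨P, hP⟩ := Int.gcd_dvd_left (a := g) (b := n₂)
    obtain ⟨M, hM⟩ := Int.gcd_dvd_right (a := g) (b := n₂)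
    refine ⟨_, P, M, hd, ?_, hP, hM⟩
    obtain ⟨x, y, h⟩ : ∃ x y : ℤ, (Int.gcd g n₂ : ℤ) = g * x + n₂ * y :=
      ⟨_, _, Int.gcd_eq_gcd_ab _ _⟩
    refine ⟨x, y, mul_left_cancel₀ hd ?_⟩
    linear_combination -h - x * hP - y * hM
  obtain ⟨x, y, hxy⟩ := hPM
  have hP0 : P ≠ 0 := by
    rintro rfl
    exact hN (by exact_mod_cast (by simpa using hP))
  -- with `x P + y M = 1`, the vector `(-y S, R)` lies in the lattice:
  -- `R n₂ = g S` and `y M = 1 - x P`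
  refine ⟨P, -(y * S), R, hP0, by rintro rfl; simp [hg] at hR, fun v => ⟨fun ⟨k, hk⟩ => ?_, ?_⟩⟩
  · have h1 : v.1 * (R * M) + v.2 * S = R * P * k := by
      apply mul_left_cancel₀ hd
      rw [hP, hM, hS, hR] at hk
      linear_combination hk
    obtain ⟨n, hn⟩ : R ∣ v.2 := hRS.dvd_of_dvd_mul_right
      ⟨P * k - v.1 * M, by linear_combination h1⟩
    have hR0 : R ≠ 0 := by rintro rfl; simp [hg] at hR
    have h2 : v.1 * M + n * S = P * k := by
      apply mul_left_cancel₀ hR0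
      linear_combination h1 - S * hn
    refine ⟨(v.1 * x + y * k, n), Prod.ext ?_ (by rw [hn]; ring)⟩
    dsimp only
    linear_combination (-v.1) * hxy + y * h2
  · rintro ⟨m, rfl⟩
    dsimp only
    refine ⟨m.1 * M + m.2 * S * x, ?_⟩
    rw [hP, hM, hS, hR]
    linear_combination (-m.2 * S * d * R) * hxy

/-! ### Disjoint unions of tori as quotients of planes -/

/-- A `T₂` space covered by `d` continuous images of `ℝⁿ`, where two points have the same image
exactly when they lie in the same copy and differ by an integer vector, is a disjoint union of `d`
tori: the maps descend to the compact space `Σ _ : Fin d, (ℝ/ℤ)ⁿ`, on which they form a continuous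
bijection. -/
theorem nonempty_sigma_torus_homeomorph {X : Type*} [TopologicalSpace X] [T2Space X] {n d : ℕ}
    (f : Fin d → (Fin n → ℝ) → X) (hf : ∀ j, Continuous (f j))
    (hsurj : ∀ x, ∃ j t, f j t = x)
    (hinj : ∀ i j s t, f i s = f j t ↔ i = j ∧ ∃ m : Fin n → ℤ, ∀ l, s l = t l + m l) :
    Nonempty (X ≃ₜ (Σ _ : Fin d, UnitAddTorus (Fin n))) := by
  let π : (Fin n → ℝ) → UnitAddTorus (Fin n) := Pi.map fun _ x => (x : UnitAddCircle)
  have hπ : IsOpenQuotientMap π :=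
    IsOpenQuotientMap.piMap fun _ => QuotientAddGroup.isOpenQuotientMap_mk
  have hπ_iff : ∀ s t, π s = π t ↔ ∃ m : Fin n → ℤ, ∀ l, s l = t l + m l := by
    intro s t
    rw [funext_iff, ← Classical.skolem (p := fun l (k : ℤ) => s l = t l + k)]
    refine forall_congr' fun l => ?_
    change (s l : UnitAddCircle) = (t l : UnitAddCircle) ↔ _
    rw [← sub_eq_zero, ← AddCircle.coe_sub, AddCircle.coe_eq_zero_iff]
    refine exists_congr fun k => ?_
    rw [zsmul_one, eq_comm, sub_eq_iff_eq_add']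
  have hlift : ∀ j, ∃ g : C(UnitAddTorus (Fin n), X), g.comp ⟨π, hπ.continuous⟩ = ⟨f j, hf j⟩ :=
    fun j => ⟨_, hπ.isQuotientMap.lift_comp ⟨f j, hf j⟩ fun s t h =>
      (hinj j j s t).2 ⟨rfl, (hπ_iff s t).1 h⟩⟩
  choose g hg using hlift
  replace hg : ∀ j t, g j (π t) = f j t := fun j t => DFunLike.congr_fun (hg j) t
  have hbij : Function.Bijective (fun z : Σ _ : Fin d, UnitAddTorus (Fin n) => g z.1 z.2) := by
    refine ⟨?_, fun x => ?_⟩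
    · rintro ⟨i, y⟩ ⟨j, z⟩ h
      obtain ⟨s, rfl⟩ := hπ.surjective y
      obtain ⟨t, rfl⟩ := hπ.surjective z
      simp only [hg] at h
      obtain ⟨rfl, hm⟩ := (hinj _ _ _ _).1 h
      rw [(hπ_iff s t).2 hm]
    · obtain ⟨j, t, rfl⟩ := hsurj x
      exact ⟨⟨j, π t⟩, hg j t⟩
  exact ⟨(Continuous.homeoOfEquivCompactToT2 (f := Equiv.ofBijective _ hbij)
    (continuous_sigma fun j => (g j).continuous)).symm⟩

/-! ### Labels and faces of the Tonnetz -/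

section
variable {N n₁ n₂ n₃ : ℕ}

theorem natCast_latticeHom (v : ℤ × ℤ) :
    latticeHom (n₁ : ZMod N) (n₂ : ZMod N) v = ((v.1 * n₁ + v.2 * n₂ : ℤ) : ZMod N) := by
  simp [latticeHom_apply]

/-- The elements `0, ±n₁, ±n₂, ±(n₁ + n₂)` of `ℤ/N` are pairwise distinct. As `-n₃ = n₁ + n₂`, these
are `0` and the `±nᵢ`; two of them would coincide if two of the `nᵢ` were equal or if
`n₃ = N / 2`. -/
theorem starInjective_tonnetz (hN : n₁ + n₂ + n₃ = N) (h₁ : 1 ≤ n₁) (h₁₂ : n₁ < n₂)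
    (h₂₃ : n₂ < n₃) (h₃ : 2 * n₃ ≠ N) :
    StarInjective (n₁ : ZMod N) (n₂ : ZMod N) := by
  have star : ∀ v : ℤ × ℤ, |v.1| ≤ 1 → |v.2| ≤ 1 → |v.1 - v.2| ≤ 1 →
      v = (0, 0) ∨ v = (1, 0) ∨ v = (-1, 0) ∨ v = (0, 1) ∨ v = (0, -1) ∨ v = (1, 1) ∨
        v = (-1, -1) := by
    rintro ⟨x, y⟩ h1 h2 h3
    simp only [abs_le, Prod.mk.injEq] at *
    omega
  intro v w h v1 v2 v3 w1 w2 w3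
  rw [natCast_latticeHom, natCast_latticeHom, ZMod.intCast_eq_intCast_iff_dvd_sub] at h
  obtain ⟨k, hk⟩ := h
  have hv := star v v1 v2 v3
  have hw := star w w1 w2 w3
  subst hN
  -- both labels are at most `n₁ + n₂ < N` in absolute value,
  -- so their difference lies in `(-2N, 2N)`
  have hk' : k = -1 ∨ k = 0 ∨ k = 1 := by
    have h1 : -2 < k := by
      by_contra! h
      have : ((n₁ + n₂ + n₃ : ℕ) : ℤ) * k ≤ ((n₁ + n₂ + n₃ : ℕ) : ℤ) * (-2) := by gcongr
      rcases hv with rfl | rfl | rfl | rfl | rfl | rfl | rfl <;>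
      rcases hw with rfl | rfl | rfl | rfl | rfl | rfl | rfl <;> dsimp only at hk <;> omega
    have h2 : k < 2 := by
      by_contra! h
      have : ((n₁ + n₂ + n₃ : ℕ) : ℤ) * 2 ≤ ((n₁ + n₂ + n₃ : ℕ) : ℤ) * k := by gcongr
      rcases hv with rfl | rfl | rfl | rfl | rfl | rfl | rfl <;>
      rcases hw with rfl | rfl | rfl | rfl | rfl | rfl | rfl <;> dsimp only at hk <;> omega
    omega
  rcases hk' with rfl | rfl | rfl <;>
  rcases hv with rfl | rfl | rfl | rfl | rfl | rfl | rfl <;>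
  rcases hw with rfl | rfl | rfl | rfl | rfl | rfl | rfl <;> dsimp only at hk <;>
  first | rfl | omega

variable (hN : n₁ + n₂ + n₃ = N)

/-- Every face lies in a triangle. The inversions of `{0, n₁, n₁ + n₂}` are written as translates
of `{0, n₂, n₁ + n₂}`, the labels of an upper triangle of a unit square. -/
theorem exists_triangle_of_mem_faces {s : Finset (ZMod N)}
    (hs : s ∈ (tonnetz N n₁ n₂ n₃ hN).faces) :
    ∃ k : ZMod N, s ⊆ {k, k + n₁, k + n₁ + n₂} ∨ s ⊆ {k, k + n₂, k + n₁ + n₂} := by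
  have h0 : (n₁ : ZMod N) + n₂ + n₃ = 0 := by
    rw [← ZMod.natCast_self N, ← hN]; push_cast; rfl
  rcases hs with ⟨k, rfl⟩ | ⟨k, rfl | rfl | rfl⟩ | ⟨k, rfl | rfl⟩
  · exact ⟨k, Or.inl (by grind)⟩
  · exact ⟨k, Or.inl (by grind)⟩
  · exact ⟨k, Or.inr (by grind)⟩
  · refine ⟨k + n₃, Or.inl ?_⟩
    have : k + n₃ + n₁ + n₂ = k := by linear_combination h0
    grind
  · exact ⟨k, Or.inl subset_rfl⟩
  · refine ⟨k - n₁ - n₂, Or.inr ?_⟩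
    have e1 : k - n₁ - n₂ + n₂ = k - n₁ := by ring
    have e2 : k - n₁ - n₂ + n₁ + n₂ = k := by ring
    rw [e1, e2]
    grind

theorem lower_mem_faces (k : ZMod N) :
    {k, k + (n₁ : ZMod N), k + n₁ + n₂} ∈ (tonnetz N n₁ n₂ n₃ hN).faces :=
  Or.inr (Or.inr ⟨k, Or.inl rfl⟩)

theorem upper_mem_faces (k : ZMod N) :
    {k, k + (n₂ : ZMod N), k + n₁ + n₂} ∈ (tonnetz N n₁ n₂ n₃ hN).faces := by
  refine Or.inr (Or.inr ⟨k + n₁ + n₂, Or.inr ?_⟩)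
  have e1 : k + n₁ + n₂ - n₁ = k + n₂ := by ring
  have e2 : k + n₁ + n₂ - n₁ - n₂ = k := by ring
  rw [e1, add_sub_cancel_right]
  grind
end

/-! ### Points of a triangle of a geometric realization -/

section
variable {ι : Type*} [DecidableEq ι]

theorem eq_single_add_single_add_single {i j k : ι} (hij : i ≠ j) (hik : i ≠ k) (hjk : j ≠ k)
    {x : ι → ℝ} (hx : ∀ l ∉ ({i, j, k} : Finset ι), x l = 0) :
    x = Pi.single i (x i) + Pi.single j (x j) + Pi.single k (x k) := by
  funext l
  have := hx l
  simp only [Pi.add_apply, Pi.single_apply]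
  grind

variable [Fintype ι]

theorem single_add_single_add_single_mem {K : AbstractSimplicialComplex ι} {i j k : ι}
    (h : {i, j, k} ∈ K.faces) {x y z : ℝ}
    (hx : 0 ≤ x) (hy : 0 ≤ y) (hz : 0 ≤ z) (hxyz : x + y + z = 1) :
    Pi.single i x + Pi.single j y + Pi.single k z ∈ geometricRealization K := by
  refine ⟨⟨fun l => ?_, ?_⟩, _, h, fun l hl => ?_⟩
  · simp only [Pi.add_apply, Pi.single_apply]
    positivity
  · simp [Finset.sum_add_distrib, hxyz]
  · simp only [Finset.mem_insert, Finset.mem_singleton, not_or] at hl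
    simp [hl]

theorem sum_eq_add_add {i j k : ι} (hij : i ≠ j) (hik : i ≠ k) (hjk : j ≠ k)
    {x : ι → ℝ} (hx : ∀ l ∉ ({i, j, k} : Finset ι), x l = 0) :
    ∑ l, x l = x i + x j + x k := by
  conv_lhs => rw [eq_single_add_single_add_single hij hik hjk hx]
  simp [Finset.sum_add_distrib]
end

/-! ### Planes covering the Tonnetz -/

theorem foldMap_mem {N n₁ n₂ n₃ : ℕ} [NeZero N] (hN : n₁ + n₂ + n₃ = N) (c : ZMod N) (p : ℝ × ℝ) :
    foldMap (n₁ : ZMod N) n₂ c p ∈ geometricRealization (tonnetz N n₁ n₂ n₃ hN) := by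
  obtain ⟨m, s, t, rfl, hs, hs1, ht, ht1⟩ := exists_latticePoint_add p
  rcases le_total t s with h | h
  · rw [foldMap_lower _ _ _ m ht h hs1.le]
    exact single_add_single_add_single_mem (lower_mem_faces hN _) (by linarith) (by linarith)
      (by linarith) (by ring)
  · rw [foldMap_upper _ _ _ m hs h ht1.le]
    exact single_add_single_add_single_mem (upper_mem_faces hN _) (by linarith) (by linarith)
      (by linarith) (by ring)

/-- The images of the planes cover the realization: barycentric coordinates in a triangle give a
point of the unit square at the origin. -/
theorem exists_foldMap_eq {N n₁ n₂ n₃ : ℕ} [NeZero N] (hN : n₁ + n₂ + n₃ = N)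
    (hinj : StarInjective (n₁ : ZMod N) (n₂ : ZMod N)) {x : ZMod N → ℝ}
    (hx : x ∈ geometricRealization (tonnetz N n₁ n₂ n₃ hN)) :
    ∃ c p, foldMap (n₁ : ZMod N) n₂ c p = x := by
  obtain ⟨⟨hx0, hx1⟩, s, hs, hsx⟩ := hx
  have ha : (n₁ : ZMod N) ≠ 0 := fun h => by
    simpa using hinj (1, 0) 0 (by simp [latticeHom_apply, h])
  have hb : (n₂ : ZMod N) ≠ 0 := fun h => by
    simpa using hinj (0, 1) 0 (by simp [latticeHom_apply, h])
  have hab : (n₁ : ZMod N) + n₂ ≠ 0 := fun h => by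
    simpa using hinj (1, 1) 0 (by simp [latticeHom_apply, h])
  obtain ⟨k, hk | hk⟩ := exists_triangle_of_mem_faces hN hs
  · have h' : ∀ l ∉ ({k, k + (n₁ : ZMod N), k + n₁ + n₂} : Finset _), x l = 0 :=
      fun l hl => hsx l fun h => hl (hk h)
    have d1 : k ≠ k + n₁ := by simpa using ha
    have d2 : k ≠ k + n₁ + n₂ := by simpa [add_assoc] using hab
    have d3 : k + n₁ ≠ k + n₁ + n₂ := by simpa using hb
    have hsum := sum_eq_add_add d1 d2 d3 h'
    have n0 := hx0 k
    have n1 := hx0 (k + n₁)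
    have n2 := hx0 (k + n₁ + n₂)
    refine ⟨k, latticePoint 0 + (x (k + n₁) + x (k + n₁ + n₂), x (k + n₁ + n₂)), ?_⟩
    rw [foldMap_lower _ _ _ 0 n2 (by linarith) (by linarith), map_zero, add_zero,
      add_sub_cancel_right]
    convert (eq_single_add_single_add_single d1 d2 d3 h').symm using 4
    linarith
  · have h' : ∀ l ∉ ({k, k + (n₂ : ZMod N), k + n₁ + n₂} : Finset _), x l = 0 :=
      fun l hl => hsx l fun h => hl (hk h)
    have d1 : k ≠ k + n₂ := by simpa using hb
    have d2 : k ≠ k + n₁ + n₂ := by simpa [add_assoc] using hab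
    have d3 : k + n₂ ≠ k + n₁ + n₂ := by simpa [add_right_comm k] using ha
    have hsum := sum_eq_add_add d1 d2 d3 h'
    have n0 := hx0 k
    have n1 := hx0 (k + n₂)
    have n2 := hx0 (k + n₁ + n₂)
    refine ⟨k, latticePoint 0 + (x (k + n₁ + n₂), x (k + n₂) + x (k + n₁ + n₂)), ?_⟩
    rw [foldMap_upper _ _ _ 0 n2 (by linarith) (by linarith), map_zero, add_zero,
      add_sub_cancel_right]
    convert (eq_single_add_single_add_single d1 d2 d3 h').symm using 4
    linarith

theorem mainTheorem2 (N n₁ n₂ n₃ : ℕ) [NeZero N] (hN : n₁ + n₂ + n₃ = N)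
    (h₁ : 1 ≤ n₁) (h₁₂ : n₁ < n₂) (h₂₃ : n₂ < n₃) (h₃ : (n₃ : ℚ) ≠ (N : ℚ) / 2) :
    ∃ d : ℕ, 0 < d ∧
      Nonempty (geometricRealization (tonnetz N n₁ n₂ n₃ hN) ≃ₜ
        (Σ _ : Fin d, UnitAddTorus (Fin 2))) := by
  have hinj : StarInjective (n₁ : ZMod N) (n₂ : ZMod N) := by
    refine starInjective_tonnetz hN h₁ h₁₂ h₂₃ fun h => h₃ ?_
    rw [eq_div_iff two_ne_zero, mul_comm]
    exact_mod_cast h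
  obtain ⟨p, q, r, hp, hr, hbasis⟩ := exists_basis_of_dvd N n₁ n₂ (NeZero.ne N)
  set φ := latticeHom (n₁ : ZMod N) (n₂ : ZMod N) with hφ
  have hker : ∀ v, φ v = 0 ↔ ∃ m : ℤ × ℤ, v = (m.1 * p + m.2 * q, m.2 * r) := fun v => by
    rw [← hbasis, hφ, natCast_latticeHom, ZMod.intCast_zmod_eq_zero_iff_dvd]
  -- the components correspond to the cosets of the subgroup generated by `n₁` and `n₂`
  let e := (Finite.equivFin (ZMod N ⧸ φ.range)).symm
  let c : Fin _ → ZMod N := fun j => (e j).out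
  have hc : ∀ j, (c j : ZMod N ⧸ φ.range) = e j := fun j => Quotient.out_eq _
  -- the linear map that carries `ℤ²` onto the lattice of label-preserving translations
  let A : (Fin 2 → ℝ) → ℝ × ℝ := fun t => (t 0 * p + t 1 * q, t 1 * r)
  have hp' : (p : ℝ) ≠ 0 := by exact_mod_cast hp
  have hr' : (r : ℝ) ≠ 0 := by exact_mod_cast hr
  refine ⟨_, Nat.card_pos, nonempty_sigma_torus_homeomorph
    (fun j t => ⟨foldMap (n₁ : ZMod N) n₂ (c j) (A t), foldMap_mem hN _ _⟩) ?_ ?_ ?_⟩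
  · exact fun j => ((continuous_foldMap _ _ _).comp (by fun_prop)).subtype_mk _
  · rintro ⟨x, hx⟩
    obtain ⟨k, z, rfl⟩ := exists_foldMap_eq hN hinj hx
    obtain ⟨j, hj⟩ := e.surjective (k : ZMod N ⧸ φ.range)
    rw [← hc, QuotientAddGroup.eq] at hj
    obtain ⟨w, hw⟩ := hj
    obtain ⟨t, ht⟩ : ∃ t, A t = z + latticePoint w := by
      refine ⟨![((z + latticePoint w).1 - (z + latticePoint w).2 / r * q) / p,
        (z + latticePoint w).2 / r], Prod.ext ?_ ?_⟩
      · simp only [A, Matrix.cons_val_zero, Matrix.cons_val_one]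
        field_simp
        ring
      · simp only [A, Matrix.cons_val_one, Matrix.cons_val_fin_one]
        field_simp
    refine ⟨j, t, Subtype.ext ?_⟩
    dsimp only
    rw [ht, foldMap_add_latticePoint, ← hφ, hw, add_neg_cancel_left]
  · intro i j s t
    rw [Subtype.mk.injEq, foldMap_eq_iff hinj]
    constructor
    · rintro ⟨w, hw, hcw⟩
      obtain rfl : i = j := by
        apply e.injective
        rw [← hc, ← hc, QuotientAddGroup.eq, hcw, neg_add_cancel_left]
        exact ⟨w, rfl⟩
      obtain ⟨m, rfl⟩ := (hker w).1 (by simpa using hcw)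
      refine ⟨rfl, ![m.1, m.2], ?_⟩
      simp only [A, latticePoint, Prod.mk_add_mk, Prod.mk.injEq] at hw
      obtain ⟨hw1, hw2⟩ := hw
      push_cast at hw1 hw2
      have e1 : s 1 = t 1 + m.2 := mul_right_cancel₀ hr' (by linear_combination hw2)
      have e0 : s 0 = t 0 + m.1 := mul_right_cancel₀ hp' (by linear_combination hw1 - q * e1)
      simpa [Fin.forall_fin_two] using ⟨e0, e1⟩
    · rintro ⟨rfl, m, hm⟩
      refine ⟨(m 0 * p + m 1 * q, m 1 * r), ?_, ?_⟩
      · simp only [A, latticePoint, hm]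
        push_cast
        ext <;> simp <;> ring
      · rw [← hφ, (hker _).2 ⟨(m 0, m 1), rfl⟩, add_zero]
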